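/- Let $(M,g)$ be a smooth Riemannian manifold of dimension $2n+1$ with Levi-Civita connection $\nabla$, curvature tensor $R(X,Y)Z=\nabla_X\nabla_YZ-\nabla_Y\nabla_XZ-\nabla_{[X,Y]}Z$, Ricci tensor $S$ and scalar curvature $r$. Suppose $(\Phi,\xi,\eta,g)$ is a Kenmotsu structure on $M$: $\Phi$ is a smooth $(1,1)$-tensor field, $\xi$ a smooth vector field and $\eta$ a smooth $1$-form with $\Phi^2X=-X+\eta(X)\xi$, $\eta\circ\Phi=0$, $\Phi\xi=0$, $\eta(\xi)=1$, $g(\Phi X,\Phi Y)=g(X,Y)-\eta(X)\eta(Y)$, $g(X,\Phi Y)=-g(\Phi X,Y)$, $g(X,\xi)=\eta(X)$ and $(\nabla_X\Phi)Y=-g(X,\Phi Y)\xi-\eta(Y)\Phi X$ for all vector fields $X,Y$. Let $S^*(X,Y)=\tfrac12\operatorname{Tr}\bigl(\Phi\circ R(X,\Phi Y)\bigr)$ be the $*$-Ricci tensor and $r^*=\operatorname{Tr}_g S^*$ the $*$-scalar curvature. Suppose that, for real constants $\Omega$ and $\omega$, $(g,\xi,\Omega,\omega)$ is a $*$-Ricci-Bourguignon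 soliton with potential vector field $\xi$, i.e. $\mathcal L_\xi g+2S^*=2(\Omega+\omega r^*)\,g$. The soliton is called compressing, balancing or enlarging if $\Omega>0$, $\Omega=0$ or $\Omega<0$, respectively. Then, at every point of $M$, $$\Omega=-\omega(4n^2+r);$$ consequently the soliton is compressing, balancing or enlarging if and only if $\omega(4n^2+r)<0$, $\omega(4n^2+r)=0$ or $\omega(4n^2+r)>0$, respectively, and if $\omega\neq0$, then $r=-4n^2-\Omega/\omega$ on $M$. -/

import Mathlib

open scoped Manifold ContDiff Bundle
open Bundle

noncomputable section

namespace StarRB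

section Riemannian

variable {m : ℕ} {M : Type*} [TopologicalSpace M] [ChartedSpace (EuclideanSpace ℝ (Fin m)) M]

/-- A (not necessarily smooth) vector field on an `m`-dimensional manifold. -/
abbrev VField (m : ℕ) (M : Type*) [TopologicalSpace M]
    [ChartedSpace (EuclideanSpace ℝ (Fin m)) M] : Type _ :=
  (x : M) → TangentSpace (𝓡 m) x

/-- Smoothness of a vector field, as a section of the tangent bundle. -/
def IsSmoothVField [IsManifold (𝓡 m) ∞ M] (X : VField m M) : Prop :=
  ContMDiff (𝓡 m) ((𝓡 m).prod 𝓘(ℝ, EuclideanSpace ℝ (Fin m))) ∞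
    (fun x ↦ TotalSpace.mk' (EuclideanSpace ℝ (Fin m)) x (X x))

/-- A vector field, smooth near `x`, whose value at `x` is `v`. -/
def ext [IsManifold (𝓡 m) ∞ M] {x : M} (v : TangentSpace (𝓡 m) x) : VField m M :=
  FiberBundle.extend (EuclideanSpace ℝ (Fin m)) v

/-- The Lie bracket of vector fields. -/
def bracket (X Y : VField m M) : VField m M :=
  VectorField.mlieBracket (𝓡 m) X Y

/-- The derivative `X f` of a function along a vector field. -/
def dirDeriv (X : VField m M) (f : M → ℝ) (x : M) : ℝ :=
  mvfderiv (𝓡 m) f x (X x)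

variable [IsManifold (𝓡 m) ∞ M]
  [RiemannianBundle (fun x : M ↦ TangentSpace (𝓡 m) x)]

/-- The function `g(X, Y)`, for the Riemannian metric `g` of `M`. -/
def metric (X Y : VField m M) (x : M) : ℝ := inner ℝ (X x) (Y x)

/-- An orthonormal basis of the tangent space at `x`, for the Riemannian metric. -/
def frame (m : ℕ) {M : Type*} [TopologicalSpace M]
    [ChartedSpace (EuclideanSpace ℝ (Fin m)) M] [IsManifold (𝓡 m) ∞ M]
    [RiemannianBundle (fun x : M ↦ TangentSpace (𝓡 m) x)] (x : M) : OrthonormalBasis (Fin (Module.finrank ℝ (TangentSpace (𝓡 m) x))) ℝ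
    (TangentSpace (𝓡 m) x) :=
  haveI : FiniteDimensional ℝ (TangentSpace (𝓡 m) x) :=
    inferInstanceAs (FiniteDimensional ℝ (EuclideanSpace ℝ (Fin m)))
  stdOrthonormalBasis ℝ (TangentSpace (𝓡 m) x)

/-- The right-hand side of Koszul's formula for `2 g(∇_X Y, Z)`. -/
def koszul (X Y Z : VField m M) (x : M) : ℝ :=
  dirDeriv X (metric Y Z) x + dirDeriv Y (metric Z X) x - dirDeriv Z (metric X Y) x
    - metric X (bracket Y Z) x - metric Y (bracket X Z) x + metric Z (bracket X Y) x

/-- The Levi-Civita connection of the metric: `nabla X Y = ∇_X Y` is the vector field which is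
determined by Koszul's formula `2 g(∇_X Y, Z) = koszul X Y Z`. As the formula is tensorial in `Z`,
the component of `∇_X Y` along a member `e` of an orthonormal basis of the tangent space at `x` is
half the right-hand side for any `Z`, differentiable at `x`, with `Z x = e`. -/
def nabla (X Y : VField m M) : VField m M := fun x ↦
  ∑ i, (koszul X Y (ext (frame m x i)) x / 2) • frame m x i

/-- The Riemann curvature `R(X, Y) Z = ∇_X ∇_Y Z - ∇_Y ∇_X Z - ∇_[X, Y] Z`. -/
def curvature (X Y Z : VField m M) : VField m M :=
  nabla X (nabla Y Z) - nabla Y (nabla X Z) - nabla (bracket X Y) Z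

/-- The value at a point of the curvature tensor on tangent vectors. -/
def curvatureAt (x : M) (u v w : TangentSpace (𝓡 m) x) : TangentSpace (𝓡 m) x :=
  curvature (ext u) (ext v) (ext w) x

/-- The Ricci tensor `S(u, v) = Tr (e ↦ R(e, u) v)`. -/
def ricci (x : M) (u v : TangentSpace (𝓡 m) x) : ℝ :=
  ∑ i, inner ℝ (curvatureAt x (frame m x i) u v) (frame m x i)

/-- The scalar curvature, the trace of the Ricci tensor. -/
def scalarCurvature (m : ℕ) {M : Type*} [TopologicalSpace M]
    [ChartedSpace (EuclideanSpace ℝ (Fin m)) M] [IsManifold (𝓡 m) ∞ M]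
    [RiemannianBundle (fun x : M ↦ TangentSpace (𝓡 m) x)] (x : M) : ℝ := ∑ i, ricci x (frame m x i) (frame m x i)

/-- The Lie derivative `(𝓛_Z g)(X, Y)` of the metric. -/
def lieDerivMetric (Z X Y : VField m M) (x : M) : ℝ :=
  dirDeriv Z (metric X Y) x - metric (bracket Z X) Y x - metric X (bracket Z Y) x

/-- The `∗`-Ricci tensor of a `(1, 1)`-tensor field `φ`:
`S∗(u, v) = 1/2 Tr (φ ∘ R(u, φ v))`. -/
def starRicci (φ : (x : M) → TangentSpace (𝓡 m) x →L[ℝ] TangentSpace (𝓡 m) x) (x : M)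
    (u v : TangentSpace (𝓡 m) x) : ℝ :=
  (∑ i, inner ℝ (φ x (curvatureAt x u (φ x v) (frame m x i))) (frame m x i)) / 2

/-- The `∗`-scalar curvature, the trace of the `∗`-Ricci tensor. -/
def starScalarCurvature (φ : (x : M) → TangentSpace (𝓡 m) x →L[ℝ] TangentSpace (𝓡 m) x)
    (x : M) : ℝ :=
  ∑ i, starRicci φ x (frame m x i) (frame m x i)

/-- `(φ, ξ, η)` is, together with the Riemannian metric of `M`, an almost contact metric
structure. -/
structure IsAlmostContactMetric
    (φ : (x : M) → TangentSpace (𝓡 m) x →L[ℝ] TangentSpace (𝓡 m) x)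
    (ξ : VField m M) (η : (x : M) → TangentSpace (𝓡 m) x →L[ℝ] ℝ) : Prop where
  smooth_phi : ContMDiff (𝓡 m)
    ((𝓡 m).prod 𝓘(ℝ, EuclideanSpace ℝ (Fin m) →L[ℝ] EuclideanSpace ℝ (Fin m))) ∞
    (fun x ↦ TotalSpace.mk' (EuclideanSpace ℝ (Fin m) →L[ℝ] EuclideanSpace ℝ (Fin m))
      (E := fun x : M ↦ TangentSpace (𝓡 m) x →L[ℝ] TangentSpace (𝓡 m) x) x (φ x))
  smooth_xi : IsSmoothVField ξ
  smooth_eta : ContMDiff (𝓡 m) ((𝓡 m).prod 𝓘(ℝ, EuclideanSpace ℝ (Fin m) →L[ℝ] ℝ)) ∞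
    (fun x ↦ TotalSpace.mk' (EuclideanSpace ℝ (Fin m) →L[ℝ] ℝ)
      (E := fun x : M ↦ TangentSpace (𝓡 m) x →L[ℝ] ℝ) x (η x))
  phi_phi : ∀ (x : M) (u : TangentSpace (𝓡 m) x), φ x (φ x u) = -u + η x u • ξ x
  eta_phi : ∀ (x : M) (u : TangentSpace (𝓡 m) x), η x (φ x u) = 0
  phi_xi : ∀ x : M, φ x (ξ x) = 0
  eta_xi : ∀ x : M, η x (ξ x) = 1
  inner_phi_phi : ∀ (x : M) (u v : TangentSpace (𝓡 m) x),
    inner ℝ (φ x u) (φ x v) = inner ℝ u v - η x u * η x v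
  inner_phi : ∀ (x : M) (u v : TangentSpace (𝓡 m) x), inner ℝ u (φ x v) = -inner ℝ (φ x u) v
  inner_xi : ∀ (x : M) (u : TangentSpace (𝓡 m) x), inner ℝ u (ξ x) = η x u

/-- A Kenmotsu structure: an almost contact metric structure for which
`(∇_X φ) Y = - g(X, φ Y) ξ - η(Y) φ X`, where `(∇_X φ) Y = ∇_X (φ Y) - φ (∇_X Y)`. -/
structure IsKenmotsu
    (φ : (x : M) → TangentSpace (𝓡 m) x →L[ℝ] TangentSpace (𝓡 m) x)
    (ξ : VField m M) (η : (x : M) → TangentSpace (𝓡 m) x →L[ℝ] ℝ) : Prop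
    extends IsAlmostContactMetric φ ξ η where
  nabla_phi : ∀ X Y : VField m M, IsSmoothVField X → IsSmoothVField Y → ∀ x : M,
    nabla X (fun y ↦ φ y (Y y)) x - φ x (nabla X Y x)
      = -(inner ℝ (X x) (φ x (Y x)) • ξ x) - η x (Y x) • φ x (X x)

/-- `(g, z, Ω, w)` is a `∗`-Ricci-Bourguignon soliton, for the Riemannian metric `g` of `M`:
`𝓛_z g + 2 S∗ = 2 (Ω + w r∗) g`. -/
structure IsStarRBSoliton
    (φ : (x : M) → TangentSpace (𝓡 m) x →L[ℝ] TangentSpace (𝓡 m) x)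
    (z : VField m M) (Ω w : ℝ) : Prop where
  smooth : IsSmoothVField z
  soliton_eq : ∀ X Y : VField m M, IsSmoothVField X → IsSmoothVField Y → ∀ x : M,
    lieDerivMetric z X Y x + 2 * starRicci φ x (X x) (Y x)
      = 2 * (Ω + w * starScalarCurvature φ x) * metric X Y x

end Riemannian

/-- A soliton with constant `Ω` is compressing if `Ω > 0`. -/
def IsCompressing (Ω : ℝ) : Prop := 0 < Ω

/-- A soliton with constant `Ω` is balancing if `Ω = 0`. -/
def IsBalancing (Ω : ℝ) : Prop := Ω = 0

/-- A soliton with constant `Ω` is enlarging if `Ω < 0`. -/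
def IsEnlarging (Ω : ℝ) : Prop := Ω < 0

end StarRB

end

namespace StarRB

/-! ### Derivations, Lie brackets and global extension of local vector fields. -/

section Smooth

open Filter Topology

variable {m : ℕ} {M : Type*} [TopologicalSpace M] [ChartedSpace (EuclideanSpace ℝ (Fin m)) M]
  {X Y Z : VField m M} {f : M → ℝ} {x : M}

/-! Two facts give the result: Ω + ω r* = 0 and r* = r + 4n². The first is the soliton equation
evaluated on (ξ, ξ). Since g(ξ, ξ) = 1 and [ξ, ξ] = 0, the Lie derivative term vanishes, and S*(ξ,
ξ) = 0 because φξ = 0 (`IsKenmotsu.soliton_constant_eq`).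

The second is the substance. Differentiating the Kenmotsu identity for ∇φ once more, with ∇_X ξ = X
- η(X)ξ, gives the commutator of R(X, Y) with φ (`IsKenmotsu.curvature_phi`). The rest is linear
algebra in one tangent space. The first Bianchi identity and skewness of φ turn Tr(φ ∘ R(u, φv))
into twice Σ g(R(e, u)φv, φe); the commutator then moves φ off v, giving S* = S + (m - 2)g + η ⊗ η
in dimension m (`sum_star_kenmotsu`). Its trace is r* = r + (m - 1)², with m = 2n + 1.

To apply this algebra, the Koszul formula must be shown to define a smooth, torsion-free metric
connection, and its curvature must be a tensor with the usual symmetries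
(`isAlgCurvature_curvatureAt`). Tensoriality is deduced from pair symmetry rather than checked slot
by slot. -/

theorem dirDeriv_add {g : M → ℝ} (hf : ContMDiff (𝓡 m) 𝓘(ℝ) ∞ f) (hg : ContMDiff (𝓡 m) 𝓘(ℝ) ∞ g) :
    dirDeriv X (f + g) = dirDeriv X f + dirDeriv X g := by
  funext x
  simp [dirDeriv, mvfderiv_add ((hf x).mdifferentiableAt (by simp))
    ((hg x).mdifferentiableAt (by simp))]

theorem dirDeriv_mul {g : M → ℝ} (hf : ContMDiff (𝓡 m) 𝓘(ℝ) ∞ f) (hg : ContMDiff (𝓡 m) 𝓘(ℝ) ∞ g) :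
    dirDeriv X (f * g) = f * dirDeriv X g + g * dirDeriv X f := by
  funext x
  simp [dirDeriv, mvfderiv_mul ((hf x).mdifferentiableAt (by simp))
    ((hg x).mdifferentiableAt (by simp))]

theorem dirDeriv_const (c : ℝ) : dirDeriv X (fun _ ↦ c) = 0 := by
  funext x
  simp [dirDeriv, mvfderiv_const]

theorem bracket_swap : bracket X Y = -bracket Y X :=
  VectorField.mlieBracket_swap

theorem bracket_self : bracket X X = 0 :=
  VectorField.mlieBracket_self

theorem dirDeriv_congr {X' : VField m M} {f' : M → ℝ} (hX : X x = X' x) (hf : f =ᶠ[𝓝 x] f') :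
    dirDeriv X f x = dirDeriv X' f' x := by
  simp only [dirDeriv, mvfderiv, hX, hf.mfderiv_eq]
  rfl

theorem bracket_congr {X' Y' : VField m M} (hX : X =ᶠ[𝓝 x] X') (hY : Y =ᶠ[𝓝 x] Y') :
    bracket X Y =ᶠ[𝓝 x] bracket X' Y' := by
  filter_upwards [hX.eventuallyEq_nhds, hY.eventuallyEq_nhds] with y h1 h2
  exact h1.mlieBracket_vectorField_eq h2

variable [IsManifold (𝓡 m) ∞ M]

theorem IsSmoothVField.mdifferentiableAt (hX : IsSmoothVField X) (x : M) :
    MDifferentiableAt (𝓡 m) ((𝓡 m).prod 𝓘(ℝ, EuclideanSpace ℝ (Fin m)))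
      (fun x ↦ TotalSpace.mk' (EuclideanSpace ℝ (Fin m)) x (X x)) x :=
  (hX x).mdifferentiableAt (by simp)

theorem IsSmoothVField.add (hX : IsSmoothVField X) (hY : IsSmoothVField Y) :
    IsSmoothVField (X + Y) :=
  ContMDiff.add_section hX hY

theorem IsSmoothVField.neg (hX : IsSmoothVField X) : IsSmoothVField (-X) :=
  ContMDiff.neg_section hX

theorem IsSmoothVField.sub (hX : IsSmoothVField X) (hY : IsSmoothVField Y) :
    IsSmoothVField (X - Y) :=
  ContMDiff.sub_section hX hY

theorem IsSmoothVField.smul (hf : ContMDiff (𝓡 m) 𝓘(ℝ) ∞ f) (hX : IsSmoothVField X) :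
    IsSmoothVField (f • X) :=
  ContMDiff.smul_section hf hX

theorem IsSmoothVField.bracket (hX : IsSmoothVField X) (hY : IsSmoothVField Y) :
    IsSmoothVField (bracket X Y) := by
  have : IsManifold (𝓡 m) (((⊤ : ℕ∞) : ℕ∞ω) + 1) M := ‹IsManifold (𝓡 m) ∞ M›
  have : IsManifold (𝓡 m) (minSmoothness ℝ 2) M := by
    rw [minSmoothness_of_isRCLikeNormedField]
    infer_instance
  exact ContDiff.mlieBracket_vectorField (m := ⊤) (n := ⊤) hX hY (by simp)

/-- A vector field which is smooth on a neighbourhood of `x` agrees near `x` with a globally smooth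
one. -/
theorem exists_isSmoothVField_eventuallyEq [T2Space M] {s : Set M} (hs : s ∈ 𝓝 x)
    (hX : ContMDiffOn (𝓡 m) ((𝓡 m).prod 𝓘(ℝ, EuclideanSpace ℝ (Fin m))) ∞
      (fun x ↦ TotalSpace.mk' (EuclideanSpace ℝ (Fin m)) x (X x)) s) :
    ∃ Y : VField m M, IsSmoothVField Y ∧ Y =ᶠ[𝓝 x] X := by
  obtain ⟨u, hus, hu, hxu⟩ := mem_nhds_iff.1 hs
  obtain ⟨ψ, -, hψ⟩ :=
    (SmoothBumpFunction.nhds_basis_tsupport (I := 𝓡 m) x).mem_iff.1 (hu.mem_nhds hxu)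
  refine ⟨(ψ : M → ℝ) • X, ContMDiffOn.smul_section_of_tsupport ψ.contMDiff.contMDiffOn hu hψ
    (hX.mono hus), ?_⟩
  filter_upwards [ψ.eventuallyEq_one] with y hy
  rw [Pi.smul_apply', hy]
  exact one_smul ℝ (X y)

/-- Every tangent vector extends to a smooth vector field which agrees near the base point with its
standard extension. -/
theorem exists_isSmoothVField_eventuallyEq_ext [T2Space M] (v : TangentSpace (𝓡 m) x) :
    ∃ Y : VField m M, IsSmoothVField Y ∧ Y =ᶠ[𝓝 x] ext v ∧ Y x = v := by
  obtain ⟨s, hs, h⟩ := FiberBundle.exists_contMDiffOn_extend (k := ∞) (𝓡 m)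
    (EuclideanSpace ℝ (Fin m)) (V := fun x : M ↦ TangentSpace (𝓡 m) x) v
  obtain ⟨Y, hY, hYX⟩ := exists_isSmoothVField_eventuallyEq hs h
  exact ⟨Y, hY, hYX, by rw [hYX.self_of_nhds]; exact FiberBundle.extend_apply_self _ v⟩

/-- X f is the fibre component of the tangent map of f composed with the section X. -/
theorem contMDiff_dirDeriv (hX : IsSmoothVField X) (hf : ContMDiff (𝓡 m) 𝓘(ℝ) ∞ f) :
    ContMDiff (𝓡 m) 𝓘(ℝ) ∞ (dirDeriv X f) := by
  have h1 : ContMDiff (𝓡 m).tangent 𝓘(ℝ).tangent ∞ (tangentMap (𝓡 m) 𝓘(ℝ) f) :=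
    hf.contMDiff_tangentMap (by simp)
  have h2 := h1.comp hX
  have h3 : ContMDiff 𝓘(ℝ).tangent 𝓘(ℝ) ∞ (fun p : TangentBundle 𝓘(ℝ) ℝ ↦ p.2) := 
    contMDiff_snd_tangentBundle_modelSpace ℝ 𝓘(ℝ)
  exact h3.comp h2

theorem bracket_add (hY : IsSmoothVField Y) (hZ : IsSmoothVField Z) :
    bracket X (Y + Z) = bracket X Y + bracket X Z := by
  funext x
  exact VectorField.mlieBracket_add_right (hY.mdifferentiableAt x) (hZ.mdifferentiableAt x)

theorem bracket_neg (hY : IsSmoothVField Y) : bracket X (-Y) = -bracket X Y := by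
  funext x
  have h := VectorField.mlieBracket_const_smul_right (c := (-1 : ℝ)) (V := X)
    (hY.mdifferentiableAt x)
  simpa [bracket] using h

theorem bracket_smul (hf : ContMDiff (𝓡 m) 𝓘(ℝ) ∞ f) (hY : IsSmoothVField Y) :
    bracket X (f • Y) = dirDeriv X f • Y + f • bracket X Y := by
  funext x
  exact VectorField.mlieBracket_smul_right ((hf x).mdifferentiableAt (by simp))
    (hY.mdifferentiableAt x)

theorem bracket_jacobi (hX : IsSmoothVField X) (hY : IsSmoothVField Y) (hZ : IsSmoothVField Z) :
    bracket X (bracket Y Z) = bracket (bracket X Y) Z + bracket Y (bracket X Z) := by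
  have : IsManifold (𝓡 m) (minSmoothness ℝ 3) M := by
    rw [minSmoothness_of_isRCLikeNormedField]
    infer_instance
  have h2 : minSmoothness ℝ 2 ≤ ∞ := by
    rw [minSmoothness_of_isRCLikeNormedField]
    exact ENat.LEInfty.out
  exact VectorField.leibniz_identity_mlieBracket (hX.of_le h2) (hY.of_le h2)
    (hZ.of_le h2)

/-- Expand the Jacobi identity for X, Y, fW by the Leibniz rule: the Jacobi identity for X, Y, W
removes the undifferentiated terms, and what remains is the claim times W. Choosing W x ≠ 0 gives
the claim at x; in a zero tangent space both sides vanish. -/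
theorem dirDeriv_bracket [T2Space M] (hX : IsSmoothVField X) (hY : IsSmoothVField Y)
    (hf : ContMDiff (𝓡 m) 𝓘(ℝ) ∞ f) :
    dirDeriv (bracket X Y) f = dirDeriv X (dirDeriv Y f) - dirDeriv Y (dirDeriv X f) := by
  funext x
  by_cases h : ∃ v : TangentSpace (𝓡 m) x, v ≠ 0
  · obtain ⟨v, hv⟩ := h
    obtain ⟨W, hW, -, hWv⟩ := exists_isSmoothVField_eventuallyEq_ext v
    have key := congrFun (bracket_jacobi hX hY (hW.smul hf)) x
    have hXf := contMDiff_dirDeriv hX hf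
    have hYf := contMDiff_dirDeriv hY hf
    rw [bracket_smul hf hW, bracket_smul hf hW, bracket_smul hf hW,
      bracket_add (hW.smul hYf) ((hY.bracket hW).smul hf),
      bracket_add (hW.smul hXf) ((hX.bracket hW).smul hf), bracket_smul hYf hW,
      bracket_smul hXf hW, bracket_smul hf (hY.bracket hW), bracket_smul hf (hX.bracket hW),
      bracket_jacobi hX hY hW] at key
    simp only [Pi.add_apply, Pi.smul_apply', smul_add, hWv] at key
    have : (dirDeriv X (dirDeriv Y f) x - dirDeriv Y (dirDeriv X f) x
        - dirDeriv (bracket X Y) f x) • v = 0 := by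
      refine Eq.trans ?_ (sub_eq_zero.2 key)
      module
    simp only [smul_eq_zero, hv, or_false] at this
    simp only [Pi.sub_apply]
    linarith
  · push Not at h
    simp [dirDeriv, h]

end Smooth

/-! ### The Koszul formula: locality and tensoriality. -/

section LeviCivita

open Filter Topology

variable {m : ℕ} {M : Type*} [TopologicalSpace M] [ChartedSpace (EuclideanSpace ℝ (Fin m)) M]
  [RiemannianBundle (fun x : M ↦ TangentSpace (𝓡 m) x)]
  {X Y Z W : VField m M} {f : M → ℝ} {x : M}

theorem metric_comm : metric X Y = metric Y X := by
  funext x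
  exact real_inner_comm _ _

theorem metric_add_right : metric X (Y + Z) = metric X Y + metric X Z := by
  funext x
  exact inner_add_right _ _ _

theorem metric_smul_right : metric X (f • Y) = f * metric X Y := by
  funext x
  exact inner_smul_right _ _ _

theorem metric_congr {X' Y' : VField m M} (hX : X =ᶠ[𝓝 x] X') (hY : Y =ᶠ[𝓝 x] Y') :
    metric X Y =ᶠ[𝓝 x] metric X' Y' := by
  filter_upwards [hX, hY] with y h1 h2
  rw [metric, metric, h1, h2]

theorem koszul_congr {X' Y' : VField m M} (hX : X =ᶠ[𝓝 x] X') (hY : Y =ᶠ[𝓝 x] Y') :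
    koszul X Y Z x = koszul X' Y' Z x := by
  have hZ : Z =ᶠ[𝓝 x] Z := .rfl
  simp only [koszul]
  rw [dirDeriv_congr hX.self_of_nhds (metric_congr hY hZ),
    dirDeriv_congr hY.self_of_nhds (metric_congr hZ hX),
    dirDeriv_congr (X := Z) rfl (metric_congr hX hY),
    (metric_congr hX (bracket_congr hY hZ)).self_of_nhds,
    (metric_congr hY (bracket_congr hX hZ)).self_of_nhds,
    (metric_congr hZ (bracket_congr hX hY)).self_of_nhds]

variable [IsManifold (𝓡 m) ∞ M]

/-- A vector at `x` is determined by its inner products with smooth vector fields. -/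
theorem eq_of_inner_eq [T2Space M] {u v : TangentSpace (𝓡 m) x}
    (h : ∀ Z : VField m M, IsSmoothVField Z → inner ℝ u (Z x) = inner ℝ v (Z x)) : u = v := by
  refine ext_inner_right ℝ fun w ↦ ?_
  obtain ⟨Z, hZ, -, rfl⟩ := exists_isSmoothVField_eventuallyEq_ext w
  exact h Z hZ

/-- Standard extensions of tangent vectors are smooth only near the base point; locality allows them
to be replaced by globally smooth fields. -/
theorem nabla_congr {X' Y' : VField m M} (hX : X =ᶠ[𝓝 x] X') (hY : Y =ᶠ[𝓝 x] Y') :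
    nabla X Y =ᶠ[𝓝 x] nabla X' Y' := by
  filter_upwards [hX.eventuallyEq_nhds, hY.eventuallyEq_nhds] with y h1 h2
  simp only [nabla, koszul_congr h1 h2]
  rfl

theorem curvature_congr {X' Y' Z' : VField m M} (hX : X =ᶠ[𝓝 x] X') (hY : Y =ᶠ[𝓝 x] Y')
    (hZ : Z =ᶠ[𝓝 x] Z') : curvature X Y Z x = curvature X' Y' Z' x := by
  simp only [curvature, Pi.sub_apply]
  rw [(nabla_congr hX (nabla_congr hY hZ)).self_of_nhds,
    (nabla_congr hY (nabla_congr hX hZ)).self_of_nhds,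
    (nabla_congr (bracket_congr hX hY) hZ).self_of_nhds]

variable [IsContMDiffRiemannianBundle (𝓡 m) ∞ (EuclideanSpace ℝ (Fin m))
  (fun x : M ↦ TangentSpace (𝓡 m) x)]

theorem contMDiff_metric (hX : IsSmoothVField X) (hY : IsSmoothVField Y) :
    ContMDiff (𝓡 m) 𝓘(ℝ) ∞ (metric X Y) :=
  ContMDiff.inner_bundle hX hY

theorem mdifferentiableAt_metric
    (hX : MDifferentiableAt (𝓡 m) ((𝓡 m).prod 𝓘(ℝ, EuclideanSpace ℝ (Fin m)))
      (fun x ↦ TotalSpace.mk' (EuclideanSpace ℝ (Fin m)) x (X x)) x)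
    (hY : MDifferentiableAt (𝓡 m) ((𝓡 m).prod 𝓘(ℝ, EuclideanSpace ℝ (Fin m)))
      (fun x ↦ TotalSpace.mk' (EuclideanSpace ℝ (Fin m)) x (Y x)) x) :
    MDifferentiableAt (𝓡 m) 𝓘(ℝ) (metric X Y) x :=
  haveI : IsContMDiffRiemannianBundle (𝓡 m) 1 (EuclideanSpace ℝ (Fin m))
      (fun x : M ↦ TangentSpace (𝓡 m) x) :=
    IsContMDiffRiemannianBundle.of_le (n := ∞) ENat.LEInfty.out
  MDifferentiableAt.inner_bundle hX hY

/-- For fZ in place of Z, the terms containing X f and Y f from differentiating the metric cancel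
those from the brackets [X, fZ] and [Y, fZ]. -/
theorem tensorialAt_koszul (hX : IsSmoothVField X) (hY : IsSmoothVField Y) (x : M) :
    TensorialAt (𝓡 m) (EuclideanSpace ℝ (Fin m)) (V := fun x : M ↦ TangentSpace (𝓡 m) x)
      (fun Z ↦ koszul X Y Z x) x where
  smul {f Z} hf hZ := by
    have h1 : dirDeriv X (f * metric Y Z) x = f x * dirDeriv X (metric Y Z) x
        + metric Y Z x * dirDeriv X f x := by
      simp [dirDeriv, mvfderiv_mul hf (mdifferentiableAt_metric (hY.mdifferentiableAt x) hZ)]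
    have h2 : dirDeriv Y (f * metric X Z) x = f x * dirDeriv Y (metric X Z) x
        + metric X Z x * dirDeriv Y f x := by
      simp [dirDeriv, mvfderiv_mul hf (mdifferentiableAt_metric (hX.mdifferentiableAt x) hZ)]
    have h3 : dirDeriv (f • Z) (metric X Y) x = f x * dirDeriv Z (metric X Y) x := by
      simp [dirDeriv]
    have h4 : ∀ V : VField m M, bracket V (f • Z) x
        = dirDeriv V f x • Z x + f x • bracket V Z x := fun V ↦
      VectorField.mlieBracket_smul_right hf hZ
    have h5 : metric (f • Z) (bracket X Y) x = f x * metric Z (bracket X Y) x :=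
      real_inner_smul_left _ _ _
    simp only [koszul]
    rw [metric_smul_right, metric_comm (X := f • Z) (Y := X), metric_smul_right, h1, h2, h3, h5,
      metric_comm (X := Z) (Y := X)]
    simp only [metric, h4, inner_add_right, inner_smul_right, smul_eq_mul]
    ring
  add {Z Z'} hZ hZ' := by
    have h0 : ∀ V V' : VField m M, IsSmoothVField V' →
        dirDeriv V (metric V' (Z + Z')) x
          = dirDeriv V (metric V' Z) x + dirDeriv V (metric V' Z') x := fun V V' hV' ↦ by
      rw [metric_add_right]
      simp [dirDeriv, mvfderiv_add (mdifferentiableAt_metric (hV'.mdifferentiableAt x) hZ)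
        (mdifferentiableAt_metric (hV'.mdifferentiableAt x) hZ')]
    have h3 : dirDeriv (Z + Z') (metric X Y) x
        = dirDeriv Z (metric X Y) x + dirDeriv Z' (metric X Y) x := by
      simp [dirDeriv]
    have h4 : ∀ V : VField m M, bracket V (Z + Z') x = bracket V Z x + bracket V Z' x := fun V ↦
      VectorField.mlieBracket_add_right hZ hZ'
    have h5 : metric (Z + Z') (bracket X Y) x
        = metric Z (bracket X Y) x + metric Z' (bracket X Y) x := inner_add_left _ _ _
    simp only [koszul]
    rw [metric_comm (X := Z + Z') (Y := X), metric_comm (X := Z) (Y := X),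
      metric_comm (X := Z') (Y := X), h0 X Y hY, h0 Y X hX, h3, h5]
    simp only [metric, h4, inner_add_right]
    ring

/-- By tensoriality, Z may be expanded at x in the orthonormal basis used to define `nabla`. -/
theorem metric_nabla (hX : IsSmoothVField X) (hY : IsSmoothVField Y)
    (hZ : MDifferentiableAt (𝓡 m) ((𝓡 m).prod 𝓘(ℝ, EuclideanSpace ℝ (Fin m)))
      (fun x ↦ TotalSpace.mk' (EuclideanSpace ℝ (Fin m)) x (Z x)) x) :
    metric (nabla X Y) Z x = koszul X Y Z x / 2 := by
  have hT := tensorialAt_koszul hX hY x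
  have h1 := hT.mkHom_apply hZ
  rw [← h1]
  conv_rhs => rw [← (frame m x).sum_repr' (Z x), map_sum]
  simp only [metric, nabla, sum_inner, real_inner_smul_left, Finset.sum_div]
  refine Finset.sum_congr rfl fun i _ ↦ ?_
  rw [map_smul, hT.mkHom_apply_eq_extend, smul_eq_mul, ext]
  ring

end LeviCivita

/-! ### Smoothness tested by inner products. -/

section Smooth

open Filter Topology

variable {m : ℕ} {M : Type*} [TopologicalSpace M] [ChartedSpace (EuclideanSpace ℝ (Fin m)) M]

theorem contMDiffAt_det {ι : Type*} [Fintype ι] [DecidableEq ι] {A : M → Matrix ι ι ℝ} {x : M}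
    (hA : ∀ i j, ContMDiffAt (𝓡 m) 𝓘(ℝ) ∞ (fun y ↦ A y i j) x) :
    ContMDiffAt (𝓡 m) 𝓘(ℝ) ∞ (fun y ↦ (A y).det) x := by
  simp only [Matrix.det_apply']
  exact ContMDiffAt.sum fun σ _ ↦ contMDiffAt_const.mul (ContMDiffAt.prod fun i _ ↦ hA _ _)

variable [IsManifold (𝓡 m) ∞ M] [RiemannianBundle (fun x : M ↦ TangentSpace (𝓡 m) x)]
  [IsContMDiffRiemannianBundle (𝓡 m) ∞ (EuclideanSpace ℝ (Fin m))
    (fun x : M ↦ TangentSpace (𝓡 m) x)]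

/-- A vector field whose inner products with all smooth vector fields are smooth is smooth. -/
theorem isSmoothVField_of_metric [T2Space M] {A : VField m M}
    (hA : ∀ Z, IsSmoothVField Z → ContMDiff (𝓡 m) 𝓘(ℝ) ∞ (metric A Z)) : IsSmoothVField A := by
  intro x
  let t := trivializationAt (EuclideanSpace ℝ (Fin m)) (fun x : M ↦ TangentSpace (𝓡 m) x) x
  let e := (EuclideanSpace.basisFun (Fin m) ℝ).toBasis
  have hxt : x ∈ t.baseSet := FiberBundle.mem_baseSet_trivializationAt' x
  have ht : t.baseSet ∈ 𝓝 x := t.open_baseSet.mem_nhds hxt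
  have hs := t.isLocalFrameOn_localFrame_baseSet (𝓡 m) ∞ e
  -- The hypothesis tests only globally smooth fields, so the local frame is replaced by global
  -- fields agreeing with it near x.
  choose Z hZ hZs using fun i ↦ exists_isSmoothVField_eventuallyEq ht (hs.contMDiffOn i)
  let G : M → Matrix (Fin m) (Fin m) ℝ := fun y ↦ Matrix.gram ℝ (fun i ↦ Z i y)
  -- Cramer's rule for the coefficients of A in the frame Z: the system has the Gram matrix as its
  -- matrix and the smooth functions g(A, Z j) as its right-hand side.
  let c : Fin m → M → ℝ := fun i y ↦
    (G y).det⁻¹ * ((G y).updateCol i (fun j ↦ metric A (Z j) y)).det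
  have hev : ∀ᶠ y in 𝓝 x, y ∈ t.baseSet ∧ ∀ i, Z i y = t.localFrame e i y :=
    (eventually_of_mem ht fun y hy ↦ hy).and (eventually_all.2 hZs)
  have hdet : ∀ y, y ∈ t.baseSet → (∀ i, Z i y = t.localFrame e i y) → (G y).det ≠ 0 :=
    fun y hy hyZ ↦ by
      rw [Matrix.det_gram_ne_zero_iff_linearIndependent]
      simpa only [hyZ] using hs.linearIndependent hy
  have hc : ∀ i, ContMDiffAt (𝓡 m) 𝓘(ℝ) ∞ (c i) x := fun i ↦ by
    have hG : ∀ i j, ContMDiffAt (𝓡 m) 𝓘(ℝ) ∞ (fun y ↦ G y i j) x := fun i j ↦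
      contMDiff_metric (hZ i) (hZ j) x
    refine ((contMDiffAt_det hG).inv₀ (hdet x hxt hev.self_of_nhds.2)).mul
      (contMDiffAt_det fun j k ↦ ?_)
    by_cases hk : k = i
    · subst hk
      simpa using hA _ (hZ j) x
    · simpa [Matrix.updateCol_ne hk] using hG j k
  have hAc : A =ᶠ[𝓝 x] fun y ↦ ∑ i, c i y • Z i y := by
    filter_upwards [hev] with y hy
    have h1 : A y = ∑ i, t.localFrameCoeff (𝓡 m) e i y (A y) • Z i y := by
      simpa only [hy.2] using 
        t.eq_sum_localFrameCoeff_smul (I := 𝓡 m) (b := e) (s := A) hy.1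
    set a : Fin m → ℝ := fun i ↦ t.localFrameCoeff (𝓡 m) e i y (A y)
    have h2 : (fun j ↦ metric A (Z j) y) = (G y).mulVec a := by
      funext j
      change inner ℝ (A y) (Z j y) = ∑ i, inner ℝ (Z j y) (Z i y) * a i
      rw [h1, sum_inner]
      refine Finset.sum_congr rfl fun i _ ↦ ?_
      rw [real_inner_smul_left, real_inner_comm, mul_comm]
    have h3 : ∀ i, c i y = a i := fun i ↦ by
      simp only [c]
      rw [h2, ← Matrix.cramer_apply, Matrix.cramer_eq_adjugate_mulVec, Matrix.mulVec_mulVec,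
        Matrix.adjugate_mul]
      simp [Matrix.smul_mulVec, hdet y hy.1 hy.2]
    simp only [h3]
    exact h1
  refine ContMDiffAt.congr_of_eventuallyEq (ContMDiffAt.sum_section (t := fun i ↦ c i • Z i)
    (s := Finset.univ) fun i _ ↦ ContMDiffAt.smul_section (hc i) (hZ i x)) ?_
  filter_upwards [hAc] with y hy
  rw [hy]
  rfl

end Smooth

/-! ### The Levi-Civita connection and the symmetries of its curvature on smooth fields. -/

section LeviCivita

variable {m : ℕ} {M : Type*} [TopologicalSpace M] [ChartedSpace (EuclideanSpace ℝ (Fin m)) M]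
  [IsManifold (𝓡 m) ∞ M] [RiemannianBundle (fun x : M ↦ TangentSpace (𝓡 m) x)]
  [IsContMDiffRiemannianBundle (𝓡 m) ∞ (EuclideanSpace ℝ (Fin m))
    (fun x : M ↦ TangentSpace (𝓡 m) x)]
  {X Y Z W : VField m M} {f : M → ℝ}

theorem contMDiff_koszul (hX : IsSmoothVField X) (hY : IsSmoothVField Y) (hZ : IsSmoothVField Z) :
    ContMDiff (𝓡 m) 𝓘(ℝ) ∞ (koszul X Y Z) :=
  (((((contMDiff_dirDeriv hX (contMDiff_metric hY hZ)).add
    (contMDiff_dirDeriv hY (contMDiff_metric hZ hX))).sub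
    (contMDiff_dirDeriv hZ (contMDiff_metric hX hY))).sub
    (contMDiff_metric hX (hY.bracket hZ))).sub
    (contMDiff_metric hY (hX.bracket hZ))).add
    (contMDiff_metric hZ (hX.bracket hY))

theorem metric_nabla_right (hX : IsSmoothVField X) (hY : IsSmoothVField Y)
    (hZ : IsSmoothVField Z) :
    dirDeriv X (metric Y Z) = metric (nabla X Y) Z + metric Y (nabla X Z) := by
  funext x
  simp only [Pi.add_apply]
  rw [metric_comm (X := Y) (Y := nabla X Z), metric_nabla hX hY (hZ.mdifferentiableAt x),
    metric_nabla hX hZ (hY.mdifferentiableAt x), koszul, koszul, metric_comm (X := Z) (Y := Y),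
    metric_comm (X := Z) (Y := X), metric_comm (X := Y) (Y := X), bracket_swap (X := Z) (Y := Y)]
  simp only [metric, Pi.neg_apply, inner_neg_right]
  ring

variable [T2Space M]

theorem IsSmoothVField.nabla (hX : IsSmoothVField X) (hY : IsSmoothVField Y) :
    IsSmoothVField (nabla X Y) := by
  refine isSmoothVField_of_metric fun Z hZ ↦ ?_
  have : metric (StarRB.nabla X Y) Z = fun x ↦ koszul X Y Z x * (1 / 2) := by
    funext x
    rw [metric_nabla hX hY (hZ.mdifferentiableAt x)]
    ring
  rw [this]
  exact (contMDiff_koszul hX hY hZ).mul contMDiff_const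

theorem nabla_sub_nabla (hX : IsSmoothVField X) (hY : IsSmoothVField Y) :
    nabla X Y - nabla Y X = bracket X Y := by
  funext x
  refine eq_of_inner_eq fun Z hZ ↦ ?_
  have h1 := metric_nabla hX hY (hZ.mdifferentiableAt x)
  have h2 := metric_nabla hY hX (hZ.mdifferentiableAt x)
  rw [koszul] at h1 h2
  rw [metric_comm (X := Y) (Y := X), metric_comm (X := X) (Y := Z), metric_comm (X := Z) (Y := Y),
    bracket_swap (X := Y) (Y := X)] at h2
  simp only [metric, Pi.neg_apply, inner_neg_right] at h1 h2
  rw [Pi.sub_apply, inner_sub_left, real_inner_comm (Z x) (bracket X Y x)]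
  linarith

theorem nabla_add (hX : IsSmoothVField X) (hY : IsSmoothVField Y) (hZ : IsSmoothVField Z) :
    nabla X (Y + Z) = nabla X Y + nabla X Z := by
  funext x
  refine eq_of_inner_eq fun W hW ↦ ?_
  have h1 := congrFun (metric_nabla_right hX (hY.add hZ) hW) x
  have h2 := congrFun (metric_nabla_right hX hY hW) x
  have h3 := congrFun (metric_nabla_right hX hZ hW) x
  rw [metric_comm, metric_add_right, dirDeriv_add (contMDiff_metric hW hY)
    (contMDiff_metric hW hZ), metric_comm (X := W) (Y := Y), metric_comm (X := W) (Y := Z)] at h1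
  simp only [Pi.add_apply, metric, inner_add_left] at h1 h2 h3 ⊢
  linarith

theorem nabla_smul (hX : IsSmoothVField X) (hf : ContMDiff (𝓡 m) 𝓘(ℝ) ∞ f)
    (hY : IsSmoothVField Y) : nabla X (f • Y) = dirDeriv X f • Y + f • nabla X Y := by
  funext x
  refine eq_of_inner_eq fun W hW ↦ ?_
  have h1 := congrFun (metric_nabla_right hX (hY.smul hf) hW) x
  have h2 := congrFun (metric_nabla_right hX hY hW) x
  rw [metric_comm, metric_smul_right, dirDeriv_mul hf (contMDiff_metric hW hY),
    metric_comm (X := W) (Y := Y)] at h1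
  simp only [Pi.add_apply, Pi.mul_apply, Pi.smul_apply', metric, inner_add_left,
    real_inner_smul_left, h2] at h1 ⊢
  linarith

theorem nabla_neg (hX : IsSmoothVField X) (hY : IsSmoothVField Y) :
    nabla X (-Y) = -nabla X Y := by
  have h := nabla_smul hX (f := fun _ ↦ -1) contMDiff_const hY
  rw [dirDeriv_const] at h
  have e : ∀ V : VField m M, (fun _ : M ↦ (-1 : ℝ)) • V = -V := fun V ↦ by
    funext x
    simp
  simpa [e] using h

theorem nabla_sub (hX : IsSmoothVField X) (hY : IsSmoothVField Y) (hZ : IsSmoothVField Z) :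
    nabla X (Y - Z) = nabla X Y - nabla X Z := by
  rw [sub_eq_add_neg, nabla_add hX hY hZ.neg, nabla_neg hX hZ, sub_eq_add_neg]

/-- Vanishing torsion transfers the sign rule from the second argument to the first. -/
theorem nabla_neg_left (hX : IsSmoothVField X) (hY : IsSmoothVField Y) :
    nabla (-X) Y = -nabla X Y := by
  have h1 := nabla_sub_nabla hX.neg hY
  have h2 := nabla_sub_nabla hX hY
  rw [nabla_neg hY hX, bracket_swap, bracket_neg hX, bracket_swap (X := Y), ← h2] at h1
  rw [← sub_eq_zero] at h1 ⊢
  rw [← h1]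
  abel

theorem curvature_antisymm (hX : IsSmoothVField X) (hY : IsSmoothVField Y)
    (hZ : IsSmoothVField Z) : curvature X Y Z = -curvature Y X Z := by
  simp only [curvature]
  rw [bracket_swap, nabla_neg_left (hY.bracket hX) hZ]
  abel

/-- Vanishing torsion, used twice, turns the cyclic sum into the Jacobi identity. -/
theorem curvature_bianchi (hX : IsSmoothVField X) (hY : IsSmoothVField Y)
    (hZ : IsSmoothVField Z) : curvature X Y Z + curvature Y Z X + curvature Z X Y = 0 := by
  have key : ∀ {A B C : VField m M}, IsSmoothVField A → IsSmoothVField B → IsSmoothVField C →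
      nabla A (nabla B C) - nabla A (nabla C B) - nabla (bracket B C) A
        = bracket A (bracket B C) := fun hA hB hC ↦ by
    rw [← nabla_sub hA (hB.nabla hC) (hC.nabla hB), nabla_sub_nabla hB hC,
      nabla_sub_nabla hA (hB.bracket hC)]
  have h := bracket_jacobi hX hY hZ
  rw [bracket_swap (X := bracket X Y) (Y := Z), bracket_swap (X := X) (Y := Z),
    bracket_neg (hZ.bracket hX), ← key hX hY hZ, ← key hY hZ hX, ← key hZ hX hY,
    ← sub_eq_zero] at h
  rw [← h]
  simp only [curvature]
  abel

/-- Apply [X, Y] = XY - YX to the function g(Z, W) and expand by metric compatibility; the mixed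
terms cancel. -/
theorem curvature_skew (hX : IsSmoothVField X) (hY : IsSmoothVField Y)
    (hZ : IsSmoothVField Z) (hW : IsSmoothVField W) :
    metric (curvature X Y Z) W = -metric (curvature X Y W) Z := by
  have key : ∀ {A B : VField m M}, IsSmoothVField A → IsSmoothVField B →
      dirDeriv A (dirDeriv B (metric Z W)) = metric (nabla A (nabla B Z)) W
        + metric (nabla B Z) (nabla A W) + (metric (nabla A Z) (nabla B W)
        + metric Z (nabla A (nabla B W))) := fun hA hB ↦ by
    rw [metric_nabla_right hB hZ hW, dirDeriv_add (contMDiff_metric (hB.nabla hZ) hW)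
      (contMDiff_metric hZ (hB.nabla hW)), metric_nabla_right hA (hB.nabla hZ) hW,
      metric_nabla_right hA hZ (hB.nabla hW)]
  have h := dirDeriv_bracket hX hY (contMDiff_metric hZ hW)
  rw [key hX hY, key hY hX, metric_nabla_right (hX.bracket hY) hZ hW] at h
  funext x
  have hx := congrFun h x
  simp only [Pi.add_apply, Pi.sub_apply, Pi.neg_apply, metric, curvature, inner_sub_left] at hx ⊢
  rw [real_inner_comm (nabla X (nabla Y W) x), real_inner_comm (nabla Y (nabla X W) x),
    real_inner_comm (nabla (bracket X Y) W x)] at hx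
  linarith

end LeviCivita

/-! ### Curvature algebra and traces in a single inner product space. -/

section Algebra

open scoped InnerProductSpace

/-- The classical combination of four Bianchi identities. No linear structure on `α` is assumed, so
it applies both to tangent vectors and to vector fields not yet known to give a tensor. -/
theorem pair_symm_of_antisymm_of_skew_of_bianchi {α : Type*} {Q : α → α → α → α → ℝ}
    (antisymm : ∀ u v w z, Q u v w z = -Q v u w z) (skew : ∀ u v w z, Q u v w z = -Q u v z w)
    (bianchi : ∀ u v w z, Q u v w z + Q v w u z + Q w u v z = 0) (u v w z : α) :
    Q u v w z = Q w z u v := by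
  linarith [bianchi u v w z, bianchi v w z u, bianchi w z u v, bianchi z u v w, skew u v w z,
    skew v w z u, skew w z u v, skew z u v w, skew u w v z, skew v z u w, antisymm u w v z,
    antisymm v z u w, skew w u v z, skew z v u w, skew v w u z, skew w z v u, skew z u w v,
    skew u v z w]

variable {V ι : Type*} [NormedAddCommGroup V] [InnerProductSpace ℝ V] [Fintype ι]

/-- For a skew-adjoint `f`, the trace of `B` along `f` may be moved to the other slot. -/
theorem sum_apply_skew (b : OrthonormalBasis ι ℝ V) (f : V →ₗ[ℝ] V)
    (hf : ∀ u v : V, ⟪u, f v⟫_ℝ = -⟪f u, v⟫_ℝ) (B : V → V → ℝ)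
    (hB₁ : ∀ w (c : ι → ℝ), B (∑ j, c j • b j) w = ∑ j, c j * B (b j) w)
    (hB₂ : ∀ w (c : ι → ℝ), B w (∑ j, c j • b j) = ∑ j, c j * B w (b j)) :
    ∑ i, B (b i) (f (b i)) = -∑ i, B (f (b i)) (b i) := by
  have h₁ : ∀ i, B (b i) (f (b i)) = ∑ j, ⟪b j, f (b i)⟫_ℝ * B (b i) (b j) := fun i ↦ by
    conv_lhs => rw [← b.sum_repr' (f (b i))]
    rw [hB₂]
  have h₂ : ∀ i, B (f (b i)) (b i) = ∑ j, ⟪b j, f (b i)⟫_ℝ * B (b j) (b i) := fun i ↦ by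
    conv_lhs => rw [← b.sum_repr' (f (b i))]
    rw [hB₁]
  simp only [h₁, h₂]
  rw [Finset.sum_comm, ← Finset.sum_neg_distrib]
  refine Finset.sum_congr rfl fun i _ ↦ ?_
  rw [← Finset.sum_neg_distrib]
  refine Finset.sum_congr rfl fun j _ ↦ ?_
  rw [hf, real_inner_comm]
  ring

/-- The algebraic symmetries of a Riemann curvature tensor on an inner product space. -/
structure IsAlgCurvature (R : V → V → V → V) : Prop where
  antisymm : ∀ u v w, R u v w = -R v u w
  skew : ∀ u v w z, ⟪R u v w, z⟫_ℝ = -⟪R u v z, w⟫_ℝ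
  bianchi : ∀ u v w, R u v w + R v w u + R w u v = 0

namespace IsAlgCurvature
variable {R : V → V → V → V}

theorem bianchi_inner (hR : IsAlgCurvature R) (u v w z : V) :
    ⟪R u v w, z⟫_ℝ + ⟪R v w u, z⟫_ℝ + ⟪R w u v, z⟫_ℝ = 0 := by
  rw [← inner_add_left, ← inner_add_left, hR.bianchi, inner_zero_left]

theorem antisymm_inner (hR : IsAlgCurvature R) (u v w z : V) : ⟪R u v w, z⟫_ℝ = -⟪R v u w, z⟫_ℝ := by
  rw [hR.antisymm, inner_neg_left]

theorem pair_symm (hR : IsAlgCurvature R) (u v w z : V) : ⟪R u v w, z⟫_ℝ = ⟪R w z u, v⟫_ℝ :=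
  pair_symm_of_antisymm_of_skew_of_bianchi (Q := fun u v w z ↦ ⟪R u v w, z⟫_ℝ) hR.antisymm_inner
    hR.skew hR.bianchi_inner u v w z

/-- Linearity is not part of `IsAlgCurvature`: pair symmetry moves the slot into the inner product,
where it is automatic. -/
theorem sum_snd (hR : IsAlgCurvature R) (b : OrthonormalBasis ι ℝ V) (u w z : V) (c : ι → ℝ) :
    ⟪R u (∑ j, c j • b j) w, z⟫_ℝ = ∑ j, c j * ⟪R u (b j) w, z⟫_ℝ := by
  rw [hR.pair_symm, inner_sum]
  refine Finset.sum_congr rfl fun j _ ↦ ?_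
  rw [inner_smul_right, hR.pair_symm]

theorem sum_fst (hR : IsAlgCurvature R) (b : OrthonormalBasis ι ℝ V) (v w z : V) (c : ι → ℝ) :
    ⟪R (∑ j, c j • b j) v w, z⟫_ℝ = ∑ j, c j * ⟪R (b j) v w, z⟫_ℝ := by
  rw [hR.antisymm_inner, hR.sum_snd, ← Finset.sum_neg_distrib]
  refine Finset.sum_congr rfl fun j _ ↦ ?_
  rw [hR.antisymm_inner]
  ring

/-- If `R` is a curvature tensor and `f` is skew-adjoint, then the trace of `f ∘ R(u, f v)` is
expressed through a Ricci-type contraction. -/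
theorem sum_star (hR : IsAlgCurvature R) (b : OrthonormalBasis ι ℝ V) (f : V →ₗ[ℝ] V)
    (hf : ∀ u v : V, ⟪u, f v⟫_ℝ = -⟪f u, v⟫_ℝ) (u v : V) :
    ∑ i, ⟪f (R u (f v) (b i)), b i⟫_ℝ = 2 * ∑ i, ⟪R (b i) u (f v), f (b i)⟫_ℝ := by
  have h := sum_apply_skew b f hf (fun x y ↦ ⟪R u x (f v), y⟫_ℝ)
    (fun w c ↦ hR.sum_snd b u (f v) w c)
    (fun w c ↦ by
      rw [inner_sum]
      exact Finset.sum_congr rfl fun j _ ↦ inner_smul_right _ _ _)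
  -- Skewness of `f`, then Bianchi on u, f v, b i. By `h` and antisymmetry the two resulting terms
  -- have equal sums, whence the factor 2.
  have h₁ : ∀ i, ⟪f (R u (f v) (b i)), b i⟫_ℝ
      = ⟪R u (f (b i)) (f v), b i⟫_ℝ + ⟪R (b i) u (f v), f (b i)⟫_ℝ := fun i ↦ by
    linarith [hf (R u (f v) (b i)) (b i), hR.bianchi_inner u (f v) (b i) (f (b i)),
      hR.pair_symm (f v) (b i) u (f (b i))]
  have h₂ : ∑ i, ⟪R u (b i) (f v), f (b i)⟫_ℝ = -∑ i, ⟪R (b i) u (f v), f (b i)⟫_ℝ := by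
    rw [← Finset.sum_neg_distrib]
    exact Finset.sum_congr rfl fun i _ ↦ hR.antisymm_inner _ _ _ _
  simp only [h₁, Finset.sum_add_distrib]
  linarith

/-- The `∗`-Ricci tensor of a curvature tensor of Kenmotsu type. -/
theorem sum_star_kenmotsu (hR : IsAlgCurvature R) (b : OrthonormalBasis ι ℝ V) (f : V →ₗ[ℝ] V)
    (ξ : V) (hf : ∀ u v : V, ⟪u, f v⟫_ℝ = -⟪f u, v⟫_ℝ) (hξ : ⟪ξ, ξ⟫_ℝ = 1) (hfξ : f ξ = 0)
    (hff : ∀ u, f (f u) = -u + ⟪u, ξ⟫_ℝ • ξ)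
    (hRf : ∀ u v w, R u v (f w) - f (R u v w)
      = ⟪v, w⟫_ℝ • f u - ⟪u, w⟫_ℝ • f v + ⟪u, f w⟫_ℝ • v - ⟪v, f w⟫_ℝ • u) (u v : V) :
    ∑ i, ⟪f (R u (f v) (b i)), b i⟫_ℝ = 2 * (∑ i, ⟪R (b i) u v, b i⟫_ℝ
      + (Fintype.card ι - 2) * ⟪u, v⟫_ℝ + ⟪u, ξ⟫_ℝ * ⟪v, ξ⟫_ℝ) := by
  have hffi : ∀ u v, ⟪f u, f v⟫_ℝ = ⟪u, v⟫_ℝ - ⟪u, ξ⟫_ℝ * ⟪v, ξ⟫_ℝ := fun u v ↦ by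
    rw [hf, hff, inner_add_left, inner_neg_left, inner_smul_left, real_inner_comm v ξ]
    simp
    ring
  -- The commutator relation at (ξ, u, ξ) reads f(R(ξ, u)ξ) = f u. Pairing with f v determines R(ξ,
  -- u)ξ up to its ξ-component, which is zero by skewness.
  have hξR : ∀ u v, ⟪R ξ u v, ξ⟫_ℝ = -⟪u, v⟫_ℝ + ⟪u, ξ⟫_ℝ * ⟪v, ξ⟫_ℝ := fun u v ↦ by
    have h := congrArg (fun z ↦ ⟪f v, z⟫_ℝ) (hRf ξ u ξ)
    simp only [hfξ, inner_sub_right, inner_add_right, inner_smul_right, inner_zero_right, hf (f v),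
      hff, inner_add_left, inner_neg_left, inner_smul_left, hξ] at h
    have h0 : R ξ u 0 = 0 := by
      refine ext_inner_right ℝ fun z ↦ ?_
      rw [hR.skew, inner_zero_right, inner_zero_left, neg_zero]
    have h1 := hR.skew ξ u ξ ξ
    have h2 := hR.skew ξ u ξ v
    have h3 := real_inner_comm ξ (R ξ u ξ)
    have h4 := real_inner_comm v (R ξ u ξ)
    have h5 := real_inner_comm u v
    have h6 := real_inner_comm u ξ
    simp only [h0, inner_zero_right] at h
    simp only [← h3, show ⟪R ξ u ξ, ξ⟫_ℝ = 0 by linarith, h5, h6] at h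
    simp at h
    linarith
  -- The commutator moves `f` outside R, and ⟪f x, f y⟫ = ⟪x, y⟫ - ⟪x, ξ⟫⟪y, ξ⟫ then removes it. The
  -- sums `t₁` to `t₆` evaluate the correction terms.
  have key : ∀ i, ⟪R (b i) u (f v), f (b i)⟫_ℝ = ⟪R (b i) u v, b i⟫_ℝ
      - ⟪b i, ξ⟫_ℝ * ⟪R (b i) u v, ξ⟫_ℝ + ⟪u, v⟫_ℝ * (1 - ⟪b i, ξ⟫_ℝ * ⟪b i, ξ⟫_ℝ)
      - ⟪b i, v⟫_ℝ * ⟪f u, f (b i)⟫_ℝ + ⟪b i, f v⟫_ℝ * ⟪u, f (b i)⟫_ℝ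
      - ⟪u, f v⟫_ℝ * ⟪b i, f (b i)⟫_ℝ := fun i ↦ by
    have h : R (b i) u (f v) = f (R (b i) u v) + (⟪u, v⟫_ℝ • f (b i) - ⟪b i, v⟫_ℝ • f u
        + ⟪b i, f v⟫_ℝ • u - ⟪u, f v⟫_ℝ • b i) := by
      rw [← hRf]; abel
    rw [h]
    simp only [inner_add_left, inner_sub_left, inner_smul_left, hffi (R (b i) u v),
      hffi (b i) (b i), b.inner_eq_one]
    simp
    ring
  have t₁ : ∑ i, ⟪b i, ξ⟫_ℝ * ⟪R (b i) u v, ξ⟫_ℝ = ⟪R ξ u v, ξ⟫_ℝ := by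
    rw [← hR.sum_fst b u v ξ, b.sum_repr' ξ]
  have t₂ : ∀ x y, ∑ i, ⟪b i, x⟫_ℝ * ⟪b i, y⟫_ℝ = ⟪x, y⟫_ℝ := fun x y ↦ by
    rw [← b.sum_inner_mul_inner x y]
    exact Finset.sum_congr rfl fun i _ ↦ by rw [real_inner_comm]
  have t₃ : ∑ i, ⟪b i, v⟫_ℝ * ⟪f u, f (b i)⟫_ℝ = ⟪f u, f v⟫_ℝ := by
    rw [hffi u v, ← t₂ u v, ← t₂ v ξ, Finset.mul_sum, ← Finset.sum_sub_distrib]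
    refine Finset.sum_congr rfl fun i _ ↦ ?_
    rw [hffi u (b i), real_inner_comm u (b i)]
    ring
  have t₄ : ∑ i, ⟪b i, f v⟫_ℝ * ⟪u, f (b i)⟫_ℝ = -⟪f u, f v⟫_ℝ := by
    rw [← t₂ (f u) (f v), ← Finset.sum_neg_distrib]
    refine Finset.sum_congr rfl fun i _ ↦ ?_
    rw [hf u, real_inner_comm (f u) (b i)]
    ring
  have t₅ : ∑ i, ⟪u, f v⟫_ℝ * ⟪b i, f (b i)⟫_ℝ = 0 :=
    Finset.sum_eq_zero fun i _ ↦ by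
      have := hf (b i) (b i)
      have := real_inner_comm (b i) (f (b i))
      rw [show ⟪b i, f (b i)⟫_ℝ = 0 by linarith, mul_zero]
  rw [hR.sum_star b f hf]
  have t₆ : ∑ i, ⟪u, v⟫_ℝ * (1 - ⟪b i, ξ⟫_ℝ * ⟪b i, ξ⟫_ℝ)
      = ⟪u, v⟫_ℝ * (Fintype.card ι - 1) := by
    rw [← Finset.mul_sum, Finset.sum_sub_distrib, t₂, hξ]
    simp
  simp only [key, Finset.sum_add_distrib, Finset.sum_sub_distrib, t₁, t₃, t₄, t₅, t₆, hξR]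
  rw [hffi]
  simp
  ring

/-- The relation between the `∗`-scalar curvature and the scalar curvature of a curvature tensor of
Kenmotsu type. -/
theorem sum_sum_star_kenmotsu (hR : IsAlgCurvature R) (b : OrthonormalBasis ι ℝ V) (f : V →ₗ[ℝ] V)
    (ξ : V) (hf : ∀ u v : V, ⟪u, f v⟫_ℝ = -⟪f u, v⟫_ℝ) (hξ : ⟪ξ, ξ⟫_ℝ = 1) (hfξ : f ξ = 0)
    (hff : ∀ u, f (f u) = -u + ⟪u, ξ⟫_ℝ • ξ)
    (hRf : ∀ u v w, R u v (f w) - f (R u v w)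
      = ⟪v, w⟫_ℝ • f u - ⟪u, w⟫_ℝ • f v + ⟪u, f w⟫_ℝ • v - ⟪v, f w⟫_ℝ • u) :
    ∑ i, (∑ j, ⟪f (R (b i) (f (b i)) (b j)), b j⟫_ℝ) / 2
      = ∑ i, ∑ j, ⟪R (b j) (b i) (b i), b j⟫_ℝ + ((Fintype.card ι : ℝ) - 1) ^ 2 := by
  have t : ∑ i, ⟪b i, ξ⟫_ℝ * ⟪b i, ξ⟫_ℝ = 1 := by
    rw [← hξ, ← b.sum_inner_mul_inner ξ ξ]
    exact Finset.sum_congr rfl fun i _ ↦ by rw [real_inner_comm ξ]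
  simp only [hR.sum_star_kenmotsu b f ξ hf hξ hfξ hff hRf, mul_div_cancel_left₀ _ (two_ne_zero' ℝ),
    Finset.sum_add_distrib, t, b.inner_eq_one]
  simp
  ring

end IsAlgCurvature
end Algebra

/-! ### Tensoriality of the curvature. -/

section CurvatureTensor

variable {m : ℕ} {M : Type*} [TopologicalSpace M] [ChartedSpace (EuclideanSpace ℝ (Fin m)) M]
  [IsManifold (𝓡 m) ∞ M] [RiemannianBundle (fun x : M ↦ TangentSpace (𝓡 m) x)]
  [IsContMDiffRiemannianBundle (𝓡 m) ∞ (EuclideanSpace ℝ (Fin m))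
    (fun x : M ↦ TangentSpace (𝓡 m) x)] [T2Space M]
  {X Y Z W : VField m M}

theorem metric_curvature_pair_symm (hX : IsSmoothVField X) (hY : IsSmoothVField Y)
    (hZ : IsSmoothVField Z) (hW : IsSmoothVField W) (x : M) :
    metric (curvature X Y Z) W x = metric (curvature Z W X) Y x :=
  pair_symm_of_antisymm_of_skew_of_bianchi (α := {V : VField m M // IsSmoothVField V})
    (Q := fun A B C D ↦ metric (curvature A.1 B.1 C.1) D.1 x)
    (fun A B C D ↦ by
      simp only [curvature_antisymm A.2 B.2 C.2, metric, Pi.neg_apply, inner_neg_left])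
    (fun A B C D ↦ congrFun (curvature_skew A.2 B.2 C.2 D.2) x)
    (fun A B C D ↦ by
      have h := congrFun (curvature_bianchi A.2 B.2 C.2) x
      simp only [Pi.add_apply] at h
      simp only [metric]
      rw [← inner_add_left, ← inner_add_left, h]
      exact inner_zero_left _)
    ⟨X, hX⟩ ⟨Y, hY⟩ ⟨Z, hZ⟩ ⟨W, hW⟩

/-- The value of the curvature at `x` depends only on the values of the vector fields at `x`. -/
theorem curvature_eq_of_eq {X' Y' Z' : VField m M} {x : M} (hX : IsSmoothVField X)
    (hY : IsSmoothVField Y) (hZ : IsSmoothVField Z) (hX' : IsSmoothVField X')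
    (hY' : IsSmoothVField Y') (hZ' : IsSmoothVField Z') (h₁ : X x = X' x) (h₂ : Y x = Y' x)
    (h₃ : Z x = Z' x) : curvature X Y Z x = curvature X' Y' Z' x := by
  -- Pair symmetry puts B into the metric slot, where only its value at x counts. Antisymmetry then
  -- gives the first slot, and skewness the third.
  have snd : ∀ {A B B' C : VField m M}, IsSmoothVField A → IsSmoothVField B → IsSmoothVField B' →
      IsSmoothVField C → B x = B' x → curvature A B C x = curvature A B' C x :=
    fun {A B B' C} hA hB hB' hC h ↦ by
      refine eq_of_inner_eq fun W hW ↦ ?_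
      have e1 := metric_curvature_pair_symm hA hB hC hW x
      have e2 := metric_curvature_pair_symm hA hB' hC hW x
      simp only [metric] at e1 e2
      rw [e1, e2, h]
  have fst : ∀ {A A' B C : VField m M}, IsSmoothVField A → IsSmoothVField A' → IsSmoothVField B →
      IsSmoothVField C → A x = A' x → curvature A B C x = curvature A' B C x :=
    fun {A A' B C} hA hA' hB hC h ↦ by
      rw [curvature_antisymm hA hB hC, curvature_antisymm hA' hB hC, Pi.neg_apply, Pi.neg_apply,
        snd hB hA hA' hC h]
  have trd : curvature X' Y' Z x = curvature X' Y' Z' x := by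
    refine eq_of_inner_eq fun W hW ↦ ?_
    have e1 := congrFun (curvature_skew hX' hY' hZ hW) x
    have e2 := congrFun (curvature_skew hX' hY' hZ' hW) x
    simp only [metric, Pi.neg_apply] at e1 e2
    rw [e1, e2, h₃]
  rw [fst hX hX' hY hZ h₁, snd hX' hY hY' hZ h₂, trd]

theorem curvatureAt_apply (hX : IsSmoothVField X) (hY : IsSmoothVField Y) (hZ : IsSmoothVField Z)
    (x : M) : curvatureAt x (X x) (Y x) (Z x) = curvature X Y Z x := by
  obtain ⟨X', hX', eX, vX⟩ := exists_isSmoothVField_eventuallyEq_ext (X x)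
  obtain ⟨Y', hY', eY, vY⟩ := exists_isSmoothVField_eventuallyEq_ext (Y x)
  obtain ⟨Z', hZ', eZ, vZ⟩ := exists_isSmoothVField_eventuallyEq_ext (Z x)
  rw [curvatureAt, ← curvature_congr eX eY eZ]
  exact curvature_eq_of_eq hX' hY' hZ' hX hY hZ vX vY vZ

theorem isAlgCurvature_curvatureAt (x : M) : IsAlgCurvature (curvatureAt (m := m) x) where
  antisymm u v w := by
    obtain ⟨X, hX, -, rfl⟩ := exists_isSmoothVField_eventuallyEq_ext u
    obtain ⟨Y, hY, -, rfl⟩ := exists_isSmoothVField_eventuallyEq_ext v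
    obtain ⟨Z, hZ, -, rfl⟩ := exists_isSmoothVField_eventuallyEq_ext w
    rw [curvatureAt_apply hX hY hZ, curvatureAt_apply hY hX hZ, curvature_antisymm hX hY hZ]
    rfl
  skew u v w z := by
    obtain ⟨X, hX, -, rfl⟩ := exists_isSmoothVField_eventuallyEq_ext u
    obtain ⟨Y, hY, -, rfl⟩ := exists_isSmoothVField_eventuallyEq_ext v
    obtain ⟨Z, hZ, -, rfl⟩ := exists_isSmoothVField_eventuallyEq_ext w
    obtain ⟨W, hW, -, rfl⟩ := exists_isSmoothVField_eventuallyEq_ext z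
    rw [curvatureAt_apply hX hY hZ, curvatureAt_apply hX hY hW]
    exact congrFun (curvature_skew hX hY hZ hW) x
  bianchi u v w := by
    obtain ⟨X, hX, -, rfl⟩ := exists_isSmoothVField_eventuallyEq_ext u
    obtain ⟨Y, hY, -, rfl⟩ := exists_isSmoothVField_eventuallyEq_ext v
    obtain ⟨Z, hZ, -, rfl⟩ := exists_isSmoothVField_eventuallyEq_ext w
    rw [curvatureAt_apply hX hY hZ, curvatureAt_apply hY hZ hX, curvatureAt_apply hZ hX hY]
    exact congrFun (curvature_bianchi hX hY hZ) x

end CurvatureTensor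

/-! ### Curvature of Kenmotsu manifolds and the soliton equation. -/

section Kenmotsu

variable {m : ℕ} {M : Type*} [TopologicalSpace M] [ChartedSpace (EuclideanSpace ℝ (Fin m)) M]
  [IsManifold (𝓡 m) ∞ M] [RiemannianBundle (fun x : M ↦ TangentSpace (𝓡 m) x)]
  {φ : (x : M) → TangentSpace (𝓡 m) x →L[ℝ] TangentSpace (𝓡 m) x} {ξ : VField m M}
  {η : (x : M) → TangentSpace (𝓡 m) x →L[ℝ] ℝ} {X Y Z : VField m M}

theorem IsAlmostContactMetric.isSmoothVField_phi (h : IsAlmostContactMetric φ ξ η)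
    (hY : IsSmoothVField Y) : IsSmoothVField (fun y ↦ φ y (Y y)) := fun x ↦
  ContMDiffAt.clm_bundle_apply (h.smooth_phi x) (hY x)

theorem IsAlmostContactMetric.inner_xi_xi (h : IsAlmostContactMetric φ ξ η) (x : M) :
    inner ℝ (ξ x) (ξ x) = 1 := by
  rw [h.inner_xi, h.eta_xi]

theorem IsAlmostContactMetric.metric_xi_xi (h : IsAlmostContactMetric φ ξ η) :
    metric ξ ξ = fun _ ↦ 1 :=
  funext h.inner_xi_xi

theorem IsKenmotsu.nabla_phi_eq (h : IsKenmotsu φ ξ η) (hX : IsSmoothVField X)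
    (hY : IsSmoothVField Y) : nabla X (fun y ↦ φ y (Y y)) = (fun y ↦ φ y (nabla X Y y))
      - metric X (fun y ↦ φ y (Y y)) • ξ - metric Y ξ • fun y ↦ φ y (X y) := by
  funext x
  have h1 := h.nabla_phi X Y hX hY x
  rw [← h.inner_xi] at h1
  rw [sub_eq_iff_eq_add.1 h1]
  simp only [Pi.sub_apply, Pi.smul_apply', metric]
  abel

variable [IsContMDiffRiemannianBundle (𝓡 m) ∞ (EuclideanSpace ℝ (Fin m))
    (fun x : M ↦ TangentSpace (𝓡 m) x)] [T2Space M]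

theorem nabla_zero (hX : IsSmoothVField X) : nabla X 0 = 0 := by
  simpa using nabla_sub hX hX hX

/-- The Kenmotsu identity with Y = ξ gives φ(∇_X ξ) = φX. Applying φ again recovers ∇_X ξ, as η(∇_X
ξ) = 0 because ξ has unit length. -/
theorem IsKenmotsu.nabla_xi (h : IsKenmotsu φ ξ η) (hX : IsSmoothVField X) :
    nabla X ξ = X - metric X ξ • ξ := by
  funext x
  have h1 := h.nabla_phi X ξ hX h.smooth_xi x
  have h0 : (fun y ↦ φ y (ξ y)) = (0 : VField m M) := funext h.phi_xi
  rw [h0, nabla_zero hX, h.phi_xi, h.eta_xi] at h1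
  have h2 : φ x (nabla X ξ x) = φ x (X x) := by
    simpa using h1
  have h3 := congrFun (metric_nabla_right hX h.smooth_xi h.smooth_xi) x
  rw [h.metric_xi_xi, dirDeriv_const, metric_comm (X := ξ) (Y := nabla X ξ)] at h3
  have h4 : η x (nabla X ξ x) = 0 := by
    rw [← h.inner_xi]
    simp only [metric, Pi.zero_apply, Pi.add_apply] at h3
    linarith
  have h5 := congrArg (φ x) h2
  rw [h.phi_phi, h.phi_phi, h4, ← h.inner_xi] at h5
  simp only [Pi.sub_apply, Pi.smul_apply', metric]
  rw [← neg_inj]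
  simpa [sub_eq_add_neg, add_comm] using h5

theorem IsKenmotsu.nabla_nabla_phi (h : IsKenmotsu φ ξ η) (hX : IsSmoothVField X)
    (hY : IsSmoothVField Y) (hZ : IsSmoothVField Z) (x : M) :
    nabla X (nabla Y (fun y ↦ φ y (Z y))) x = φ x (nabla X (nabla Y Z) x)
      - inner ℝ (X x) (φ x (nabla Y Z x)) • ξ x - inner ℝ (nabla Y Z x) (ξ x) • φ x (X x)
      - ((inner ℝ (nabla X Y x) (φ x (Z x)) + inner ℝ (Y x) (nabla X (fun y ↦ φ y (Z y)) x)) • ξ x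
        + inner ℝ (Y x) (φ x (Z x)) • nabla X ξ x)
      - ((inner ℝ (nabla X Z x) (ξ x) + inner ℝ (Z x) (nabla X ξ x)) • φ x (Y x)
        + inner ℝ (Z x) (ξ x) • nabla X (fun y ↦ φ y (Y y)) x) := by
  have hξ := h.smooth_xi
  have hφ : ∀ {V : VField m M}, IsSmoothVField V → IsSmoothVField (fun y ↦ φ y (V y)) :=
    fun hV ↦ h.isSmoothVField_phi hV
  have c1 := contMDiff_metric hY (hφ hZ)
  have c2 := contMDiff_metric hZ hξ
  have e := congrFun (congrArg (nabla X) (h.nabla_phi_eq hY hZ)) x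
  rw [nabla_sub hX ((hφ (hY.nabla hZ)).sub (hξ.smul c1)) ((hφ hY).smul c2),
    nabla_sub hX (hφ (hY.nabla hZ)) (hξ.smul c1), nabla_smul hX c1 hξ, nabla_smul hX c2 (hφ hY),
    metric_nabla_right hX hY (hφ hZ), metric_nabla_right hX hZ hξ,
    h.nabla_phi_eq hX (hY.nabla hZ)] at e
  exact e

/-- Antisymmetrise the second derivative of φZ in X and Y. With [X, Y] written as ∇_X Y - ∇_Y X,
every term with a derivative of X, Y or Z cancels outside the curvature. -/
theorem IsKenmotsu.curvature_phi (h : IsKenmotsu φ ξ η) (hX : IsSmoothVField X)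
    (hY : IsSmoothVField Y) (hZ : IsSmoothVField Z) (x : M) :
    curvature X Y (fun y ↦ φ y (Z y)) x - φ x (curvature X Y Z x)
      = (inner ℝ (Y x) (Z x) : ℝ) • φ x (X x) - (inner ℝ (X x) (Z x) : ℝ) • φ x (Y x)
        + (inner ℝ (X x) (φ x (Z x)) : ℝ) • Y x - (inner ℝ (Y x) (φ x (Z x)) : ℝ) • X x := by
  have e1 := h.nabla_nabla_phi hX hY hZ x
  have e2 := h.nabla_nabla_phi hY hX hZ x
  have e3 := congrFun (h.nabla_phi_eq (hX.bracket hY) hZ) x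
  have b := congrFun (nabla_sub_nabla hX hY) x
  have s1 : inner ℝ (Y x) (φ x (X x)) = -inner ℝ (X x) (φ x (Y x)) := by
    rw [h.inner_phi, real_inner_comm]
  simp only [Pi.sub_apply, Pi.smul_apply', metric] at e3 b
  rw [← b, inner_sub_left, map_sub] at e3
  simp only [curvature, Pi.sub_apply, map_sub]
  rw [e1, e2, e3]
  simp only [h.nabla_phi_eq hX hZ, h.nabla_phi_eq hY hZ, h.nabla_phi_eq hX hY,
    h.nabla_phi_eq hY hX, h.nabla_xi hX, h.nabla_xi hY, Pi.sub_apply, Pi.smul_apply', metric,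
    inner_sub_right, inner_smul_right, s1, real_inner_comm (X x) (Z x),
    real_inner_comm (Y x) (Z x)]
  module

theorem IsKenmotsu.starScalarCurvature_eq (h : IsKenmotsu φ ξ η) (x : M) :
    starScalarCurvature φ x = scalarCurvature m x + ((m : ℝ) - 1) ^ 2 := by
  have hR := (isAlgCurvature_curvatureAt x).sum_sum_star_kenmotsu (frame m x) (φ x).toLinearMap
    (ξ x) (h.inner_phi x) (h.inner_xi_xi x) (h.phi_xi x)
    (fun u ↦ by rw [h.inner_xi]; exact h.phi_phi x u)
    (fun u v w ↦ by
      obtain ⟨X, hX, -, rfl⟩ := exists_isSmoothVField_eventuallyEq_ext u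
      obtain ⟨Y, hY, -, rfl⟩ := exists_isSmoothVField_eventuallyEq_ext v
      obtain ⟨Z, hZ, -, rfl⟩ := exists_isSmoothVField_eventuallyEq_ext w
      have e := h.curvature_phi hX hY hZ x
      rw [← curvatureAt_apply hX hY (h.isSmoothVField_phi hZ), ← curvatureAt_apply hX hY hZ] at e
      exact e)
  have hm : Fintype.card (Fin (Module.finrank ℝ (TangentSpace (𝓡 m) x))) = m := by
    rw [Fintype.card_fin]
    exact finrank_euclideanSpace_fin
  rw [hm] at hR
  exact hR

theorem IsKenmotsu.soliton_constant_eq (h : IsKenmotsu φ ξ η) {Ω w : ℝ}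
    (hS : IsStarRBSoliton φ ξ Ω w) (x : M) : Ω = -(w * starScalarCurvature φ x) := by
  have e := hS.soliton_eq ξ ξ h.smooth_xi h.smooth_xi x
  have hL : lieDerivMetric ξ ξ ξ x = 0 := by
    rw [lieDerivMetric, h.metric_xi_xi, dirDeriv_const, bracket_self]
    simp [metric]
  -- Since φξ = 0, S*(ξ, ξ) has a zero in the second curvature slot; pair symmetry shows that such a
  -- curvature vanishes.
  have hR : ∀ u w z : TangentSpace (𝓡 m) x, inner ℝ (curvatureAt x u 0 w) z = (0 : ℝ) :=
    fun u w z ↦ by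
      rw [(isAlgCurvature_curvatureAt x).pair_symm, inner_zero_right]
  have hT : starRicci φ x (ξ x) (ξ x) = 0 := by
    have h0 : ∀ z, φ x (curvatureAt x (ξ x) 0 z) = 0 := fun z ↦ by
      rw [show curvatureAt x (ξ x) 0 z = 0 from ext_inner_right ℝ fun v ↦ by
        rw [hR, inner_zero_left], map_zero]
    simp [starRicci, h.phi_xi, h0]
  rw [hL, hT, metric, h.inner_xi_xi] at e
  linarith

end Kenmotsu

end StarRB

theorem mainTheorem2 (n : ℕ) {M : Type*} [TopologicalSpace M] [T2Space M]
    [ChartedSpace (EuclideanSpace ℝ (Fin (2 * n + 1))) M] [IsManifold (𝓡 (2 * n + 1)) ∞ M]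
    [RiemannianBundle (fun x : M ↦ TangentSpace (𝓡 (2 * n + 1)) x)]
    [IsContMDiffRiemannianBundle (𝓡 (2 * n + 1)) ∞ (EuclideanSpace ℝ (Fin (2 * n + 1)))
      (fun x : M ↦ TangentSpace (𝓡 (2 * n + 1)) x)]
    (φ : (x : M) → TangentSpace (𝓡 (2 * n + 1)) x →L[ℝ] TangentSpace (𝓡 (2 * n + 1)) x)
    (ξ : StarRB.VField (2 * n + 1) M)
    (η : (x : M) → TangentSpace (𝓡 (2 * n + 1)) x →L[ℝ] ℝ)
    (hK : StarRB.IsKenmotsu φ ξ η)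
    (Ω w : ℝ) (hS : StarRB.IsStarRBSoliton φ ξ Ω w) (x : M) :
    Ω = -(w * (4 * (n : ℝ) ^ 2 + StarRB.scalarCurvature (2 * n + 1) x)) ∧
    (StarRB.IsCompressing Ω ↔
      w * (4 * (n : ℝ) ^ 2 + StarRB.scalarCurvature (2 * n + 1) x) < 0) ∧
    (StarRB.IsBalancing Ω ↔
      w * (4 * (n : ℝ) ^ 2 + StarRB.scalarCurvature (2 * n + 1) x) = 0) ∧
    (StarRB.IsEnlarging Ω ↔
      0 < w * (4 * (n : ℝ) ^ 2 + StarRB.scalarCurvature (2 * n + 1) x)) ∧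
    (w ≠ 0 →
      StarRB.scalarCurvature (2 * n + 1) x = -4 * (n : ℝ) ^ 2 - Ω / w) := by
  have h1 := hK.soliton_constant_eq hS x
  rw [hK.starScalarCurvature_eq] at h1
  have h2 : Ω = -(w * (4 * (n : ℝ) ^ 2 + StarRB.scalarCurvature (2 * n + 1) x)) := by
    rw [h1]
    -- The dimension is 2n + 1, so (m - 1)² = 4n².
    push_cast
    ring
  refine ⟨h2, ?_, ?_, ?_, fun hw ↦ ?_⟩
  · rw [StarRB.IsCompressing, h2, neg_pos]
  · rw [StarRB.IsBalancing, h2, neg_eq_zero]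
  · rw [StarRB.IsEnlarging, h2, neg_lt_zero]
  · rw [h2]
    field_simp
    ring
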